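/- Let $E\to M$ be a smooth real vector bundle of finite rank over a smooth (Hausdorff, $\sigma$-compact, finite-dimensional) manifold, and let $n\ge 1$. A derivation of $E$ is an $\mathbb R$-linear operator $\mathfrak d$ on $\Gamma(E)$ together with a vector field $\mathbbm j(\mathfrak d)\in\mathfrak X(M)$ such that $\mathfrak d(fu)=\mathbbm j(\mathfrak d)(f)\,u+f\,\mathfrak d(u)$ for all $f\in C^\infty(M)$, $u\in\Gamma(E)$. The derivations are the sections of the gauge algebroid $\mathfrak D E$, with commutator bracket $[-,-]_{\mathfrak D}$ and anchor $\mathbbm j:\mathfrak DE\to TM$, whose kernel is $\mathfrak{gl}(E)$. Let $\Omega^k(\mathfrak DE,E)=\Gamma(\mathrm{Hom}(\wedge^k\mathfrak DE,E))$, with contractions $\iota_{\mathfrak d}\mu=\mu(\mathfrak d,-,\dots,-)$, Lie derivatives $$(\mathfrak L_{\mathfrak d}\mu)(\mathfrak d_1,\dots,\mathfrak d_k)=\mathfrak d(\mu(\mathfrak d_1,\dots,\mathfrak d_k))-\sum_{i}\mu(\mathfrak d_1,\dots,[\mathfrak d,\mathfrak d_i]_{\mathfrak D},\dots,\mathfrak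 d_k),$$ and differential $$\mathbbm d\mu(\mathfrak d_0,\dots,\mathfrak d_k)=\sum_{i}(-1)^i\mathfrak d_i\big(\mu(\dots,\widehat{\mathfrak d_i},\dots)\big)+\sum_{i<j}(-1)^{i+j}\mu([\mathfrak d_i,\mathfrak d_j]_{\mathfrak D},\dots,\widehat{\mathfrak d_i},\dots,\widehat{\mathfrak d_j},\dots).$$ Let $\mathfrak J_0E=E$ and, for $k\ge1$, let $\mathfrak J_kE\subset\mathrm{Hom}(\wedge^k\mathfrak DE,E)$ consist of those $\mu$ for which there is $\lambda_\mu\in\mathrm{Hom}(\wedge^{k-1}TM,E)$ with $\iota_\Phi\mu=\Phi\circ\lambda_\mu(\mathbbm j-,\dots,\mathbbm j-)$ for all $\Phi\in\mathfrak{gl}(E)$. The operations $\iota_{\mathfrak d}$, $\mathfrak L_{\mathfrak d}$ and $\mathbbm d$ preserve the sections of $\mathfrak J_\bullet E$. Let $\mathcal E=\mathfrak DE\oplus\mathfrak J_nE$, let $\rho:\mathcal E\to\mathfrak DE$ be the projection, and for $\mathfrak d,\mathfrak r\in\Gamma(\mathfrak DE)$ and $\mu,\nu\in\Gamma(\mathfrak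 J_nE)$ put $$\{\mathfrak d+\mu,\mathfrak r+\nu\}=[\mathfrak d,\mathfrak r]_{\mathfrak D}+\mathfrak L_{\mathfrak d}\nu-\mathfrak L_{\mathfrak r}\mu+\mathbbm d\,\iota_{\mathfrak r}\mu,\qquad(\mathfrak d+\mu,\mathfrak r+\nu)_+=\tfrac12(\iota_{\mathfrak d}\nu+\iota_{\mathfrak r}\mu)\in\Gamma(\mathfrak J_{n-1}E).$$ Then for all $e,e_1,e_2,e_3\in\Gamma(\mathcal E)$ and $f\in C^\infty(M)$: (i) $(\Gamma(\mathcal E),\{-,-\})$ is a Leibniz algebra, i.e. the bracket is $\mathbb R$-bilinear and $\{e_1,\{e_2,e_3\}\}=\{\{e_1,e_2\},e_3\}+\{e_2,\{e_1,e_3\}\}$; (ii) $\rho(\{e_1,e_2\})=[\rho(e_1),\rho(e_2)]_{\mathfrak D}$; (iii) $\{e_1,fe_2\}=f\{e_1,e_2\}+\mathbbm j(\rho(e_1))(f)\,e_2$; (iv) $\mathfrak L_{\rho(e_1)}(e_2,e_3)_+=(\{e_1,e_2\},e_3)_++(e_2,\{e_1,e_3\})_+$; (v) $\{e,e\}=\mathbbm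 d(e,e)_+$. -/

import Mathlib

open scoped Manifold ContDiff Bundle Topology

namespace OmniLie

set_option linter.unusedSectionVars false

/-! ### Cartan calculus of a Lie-Rinehart algebra `L` over `A` acting on a module `P`

Below this is applied to `A = C^∞(M)`, `L = Γ(𝔇E)` and `P = Γ(E)`. -/

section Cartan

/-- A module `P` over a Lie-Rinehart algebra `L` over `A`: the action of `L` on `P` satisfies
`x (a p) = x(a) p + a (x p)` and `(a x) p = a (x p)`. -/
class LieRinehartModule (A L P : Type*) [CommRing A] [LieRing L] [Module A L]
    [LieRingModule L A] [AddCommGroup P] [Module A P] [LieRingModule L P] : Prop where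
  lie_smul' (x : L) (a : A) (p : P) : ⁅x, a • p⁆ = ⁅x, a⁆ • p + a • ⁅x, p⁆
  smul_lie' (a : A) (x : L) (p : P) : ⁅a • x, p⁆ = a • ⁅x, p⁆

variable {A L P : Type*} [CommRing A] [AddCommGroup P] [Module A P]

/-- If `D` and `T` are derivations of the modules `L` and `P` along the same derivation `δ` of the
ring `A`, then `μ ↦ T ∘ μ - ∑ i, μ (…, D -, …)` maps alternating forms to alternating forms. -/
def derAlong [AddCommGroup L] [Module A L] {n : ℕ} (δ : A → A) (D : L →+ L) (T : P →+ P)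
    (hD : ∀ a x, D (a • x) = δ a • x + a • D x) (hT : ∀ a p, T (a • p) = δ a • p + a • T p)
    (μ : L [⋀^Fin n]→ₗ[A] P) : L [⋀^Fin n]→ₗ[A] P where
  toFun v := T (μ v) - ∑ i, μ (Function.update v i (D (v i)))
  map_update_add' := by
    intro inst v i x y
    obtain rfl := Subsingleton.elim inst (instDecidableEqFin n)
    have key : ∀ j, μ (Function.update (Function.update v i (x + y)) j
        (D (Function.update v i (x + y) j))) =
        μ (Function.update (Function.update v i x) j (D (Function.update v i x j))) +
        μ (Function.update (Function.update v i y) j (D (Function.update v i y j))) := by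
      intro j
      by_cases h : j = i
      · subst h; simp
      · simp only [Function.update_of_ne h]
        simp only [Function.update_comm (Ne.symm h), AlternatingMap.map_update_add]
    simp only [key, AlternatingMap.map_update_add, map_add, Finset.sum_add_distrib]
    abel
  map_update_smul' := by
    intro inst v i c x
    obtain rfl := Subsingleton.elim inst (instDecidableEqFin n)
    have key : ∀ j, μ (Function.update (Function.update v i (c • x)) j
        (D (Function.update v i (c • x) j))) =
        (if j = i then δ c • μ (Function.update v i x) else 0) +
        c • μ (Function.update (Function.update v i x) j (D (Function.update v i x j))) := by
      intro j
      by_cases h : j = i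
      · subst h; simp [hD]
      · simp only [Function.update_of_ne h, if_neg h, zero_add]
        simp only [Function.update_comm (Ne.symm h), AlternatingMap.map_update_smul]
    simp only [key, AlternatingMap.map_update_smul, hT, Finset.sum_add_distrib,
      Finset.sum_ite_eq', Finset.mem_univ, if_true, smul_sub, Finset.smul_sum]
    abel
  map_eq_zero_of_eq' := by
    intro v i j hij hne
    have h0 : μ v = 0 := μ.map_eq_zero_of_eq v hij hne
    have hsum : ∑ k, μ (Function.update v k (D (v k))) = 0 := by
      rw [Finset.sum_eq_add i j hne]
      · have : Function.update v j (D (v j)) = Function.update v i (D (v i)) ∘ Equiv.swap i j := by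
          funext k
          simp only [Function.comp]
          by_cases hk : k = i
          · subst hk; simp [Equiv.swap_apply_left, Function.update_of_ne hne,
              Function.update_of_ne hne.symm, hij]
          · by_cases hk' : k = j
            · subst hk'; simp [hij]
            · simp [Equiv.swap_apply_of_ne_of_ne hk hk', hk, hk']
        rw [this, AlternatingMap.map_swap _ _ hne, add_neg_cancel]
      · intro k _ hk
        apply μ.map_eq_zero_of_eq _ _ hne
        rw [Function.update_of_ne hk.1.symm, Function.update_of_ne hk.2.symm, hij]
      · simp
      · simp
    simp [h0, hsum]

variable [LieRing L] [Module A L] [LieRingModule L A] [LieRinehartRing A L]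
  [LieRingModule L P] [LieRinehartModule A L P] {n : ℕ}

variable (A L P) in
/-- `P`-valued `n`-forms on the Lie-Rinehart algebra `L`: alternating `A`-multilinear maps
`L × ⋯ × L → P`. -/
abbrev Form (n : ℕ) : Type _ := L [⋀^Fin n]→ₗ[A] P

/-- Contraction `ι_x μ = μ (x, -, …, -)`. -/
def contr (x : L) (μ : Form A L P (n + 1)) : Form A L P n := μ.curryLeft x

theorem contr_apply (x : L) (μ : Form A L P (n + 1)) (v : Fin n → L) :
    contr x μ v = μ (Matrix.vecCons x v) := rfl

/-- The Lie derivative `(𝔏_x μ)(v) = x (μ(v)) - ∑ i, μ(…, [x, v i], …)`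
(see `lieDer_apply`). -/
def lieDer (x : L) (μ : Form A L P n) : Form A L P n :=
  derAlong (fun a => ⁅x, a⁆) (AddMonoidHom.mk' (fun y => ⁅x, y⁆) (lie_add x))
    (AddMonoidHom.mk' (fun p => ⁅x, p⁆) (lie_add x))
    (fun a y => by simp [add_comm])
    (fun a p => LieRinehartModule.lie_smul' x a p) μ

theorem lieDer_apply (x : L) (μ : Form A L P n) (v : Fin n → L) :
    lieDer x μ v = ⁅x, μ v⁆ - ∑ i, μ (Function.update v i ⁅x, v i⁆) := rfl

/-- The second sum
`∑_{i < j} (-1)^(i+j) μ([v i, v j], v 0, …, (omit v i), …, (omit v j), …)`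
in the formula for the differential, over pairs of indices in `Fin (n + 1)`
(with `j + 1` in place of `j`; the sign is unaffected by counting from `0`). -/
def bracketSum : {n : ℕ} → Form A L P n → (Fin (n + 1) → L) → P
  | 0, _, _ => 0
  | n + 1, μ, v => ∑ i : Fin (n + 1), ∑ j ∈ Finset.Ici i, (-1 : ℤ) ^ ((i : ℕ) + ((j : ℕ) + 1)) •
      μ (Matrix.vecCons ⁅v i.castSucc, v j.succ⁆ (j.removeNth (i.castSucc.removeNth v)))

/-- The Chevalley-Eilenberg formula
`(d μ)(v) = ∑ i, (-1)^i (v i) (μ(…, omit v i, …)) +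
  ∑_{i < j} (-1)^(i+j) μ([v i, v j], …, omit v i, …, omit v j, …)`, indices counted from `0`. -/
def dFun (μ : Form A L P n) (v : Fin (n + 1) → L) : P :=
  ∑ i : Fin (n + 1), (-1 : ℤ) ^ (i : ℕ) • ⁅v i, μ (i.removeNth v)⁆ + bracketSum μ v

/-- An equivalent form of the formula, with the bracket left in the later slot. -/
theorem dFun_eq (μ : Form A L P n) (v : Fin (n + 1) → L) :
    dFun μ v = ∑ i : Fin (n + 1), (-1 : ℤ) ^ (i : ℕ) • (⁅v i, μ (i.removeNth v)⁆ -
      ∑ j : Fin n, if (i : ℕ) ≤ j then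
        μ (Function.update (i.removeNth v) j ⁅v i, i.removeNth v j⁆) else 0) := by
  simp only [smul_sub, Finset.sum_sub_distrib]
  rw [dFun, sub_eq_add_neg]
  congr 1
  cases n with
  | zero => simp [bracketSum]
  | succ n =>
    rw [Fin.sum_univ_castSucc]
    have hlast : ∑ j : Fin (n + 1), (if ((Fin.last (n + 1) : Fin (n + 2)) : ℕ) ≤ j then
        μ (Function.update ((Fin.last (n + 1)).removeNth v) j
          ⁅v (Fin.last (n + 1)), (Fin.last (n + 1)).removeNth v j⁆) else 0) = 0 := by
      apply Finset.sum_eq_zero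
      intro j _
      rw [if_neg]
      simp only [Fin.val_last]; omega
    rw [hlast, smul_zero, add_zero, bracketSum, ← Finset.sum_neg_distrib]
    refine Finset.sum_congr rfl fun i _ => ?_
    have hI : (Finset.Ici i : Finset (Fin (n + 1))) = Finset.univ.filter (fun j => i ≤ j) := by
      ext; simp
    rw [hI, Finset.sum_filter, Finset.smul_sum, ← Finset.sum_neg_distrib]
    refine Finset.sum_congr rfl fun j _ => ?_
    by_cases h : i ≤ j
    · have h' : ((i.castSucc : Fin (n + 2)) : ℕ) ≤ j := by simpa using h
      rw [if_pos h, if_pos h']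
      have hj : i.castSucc.removeNth v j = v j.succ := by
        simp [Fin.removeNth_apply, Fin.succAbove_of_le_castSucc, h]
      rw [← Fin.insertNth_removeNth, AlternatingMap.map_insertNth, hj, smul_smul]
      rw [← neg_smul]
      congr 1
      rw [pow_add, pow_succ]
      simp
    · have h' : ¬ ((i.castSucc : Fin (n + 2)) : ℕ) ≤ j := by simpa using h
      rw [if_neg h, if_neg h']; simp

theorem dFun_cons_zero (μ : Form A L P 0) (x : L) (v : Fin 0 → L) :
    dFun μ (Matrix.vecCons x v) = lieDer x μ v := by
  simp [dFun_eq, lieDer_apply]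

theorem dFun_cons (μ : Form A L P (n + 1)) (x : L) (v : Fin (n + 1) → L) :
    dFun μ (Matrix.vecCons x v) = lieDer x μ v - dFun (contr x μ) v := by
  have hrem : ∀ k : Fin (n + 1), k.succ.removeNth (Matrix.vecCons x v) =
      Matrix.vecCons x (k.removeNth v) := by
    intro k
    funext j
    refine Fin.cases ?_ (fun j => ?_) j
    · simp [Fin.removeNth_apply]
    · simp [Fin.removeNth_apply]
  have hrem0 : (0 : Fin (n + 2)).removeNth (Matrix.vecCons x v) = v := by
    funext j; simp [Fin.removeNth_apply]
  have hup : ∀ (w : Fin n → L) (j : Fin n) (z : L), Function.update (Matrix.vecCons x w) j.succ z =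
      Matrix.vecCons x (Function.update w j z) := by
    intro w j z
    exact (Fin.cons_update (α := fun _ => L) x w j z).symm
  rw [dFun_eq, dFun_eq, Fin.sum_univ_succ,
    sub_eq_add_neg (lieDer x μ v), ← Finset.sum_neg_distrib]
  congr 1
  · simp [hrem0, lieDer_apply]
  · refine Finset.sum_congr rfl fun k _ => ?_
    rw [Fin.sum_univ_succ]
    simp only [hrem, Matrix.cons_val_succ, Fin.val_succ, Fin.val_zero, hup, contr_apply]
    rw [pow_succ, mul_neg_one, neg_smul]
    simp

theorem dFun_smul (a : A) (μ : Form A L P n) (v : Fin (n + 1) → L) :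
    dFun (a • μ) v = a • dFun μ v + ∑ i : Fin (n + 1), (-1 : ℤ) ^ (i : ℕ) • (⁅v i, a⁆ • μ (i.removeNth v)) := by
  simp only [dFun_eq, Finset.smul_sum, ← Finset.sum_add_distrib]
  refine Finset.sum_congr rfl fun i _ => ?_
  rw [smul_comm a, ← smul_add]
  congr 1
  simp only [AlternatingMap.smul_apply, LieRinehartModule.lie_smul', smul_sub, Finset.smul_sum,
    smul_ite, smul_zero]
  abel

theorem dFun_add (μ ν : Form A L P n) (v : Fin (n + 1) → L) :
    dFun (μ + ν) v = dFun μ v + dFun ν v := by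
  simp only [dFun_eq, ← Finset.sum_add_distrib]
  refine Finset.sum_congr rfl fun i _ => ?_
  rw [← smul_add]
  congr 1
  have : ∀ (c : Prop) [Decidable c] (p q : P), (if c then p + q else 0) =
    (if c then p else 0) + (if c then q else 0) := by intro c _ p q; split_ifs <;> simp
  simp only [AlternatingMap.add_apply, lie_add, this, Finset.sum_add_distrib]
  abel

theorem dFun_zero (v : Fin (n + 1) → L) : dFun (0 : Form A L P n) v = 0 := by
  simp [dFun_eq]

theorem lieDer_cons (x y : L) (μ : Form A L P (n + 1)) (w : Fin n → L) :
    lieDer x μ (Matrix.vecCons y w) = lieDer x (contr y μ) w - μ (Matrix.vecCons ⁅x, y⁆ w) := by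
  have hup : ∀ (j : Fin n) (z : L), Function.update (Matrix.vecCons y w) j.succ z =
      Matrix.vecCons y (Function.update w j z) := by
    intro j z
    exact (Fin.cons_update (α := fun _ => L) y w j z).symm
  have hup0 : ∀ z, Function.update (Matrix.vecCons y w) 0 z = Matrix.vecCons z w :=
    fun z => Fin.update_cons_zero (α := fun _ => L) y w z
  rw [lieDer_apply, lieDer_apply, Fin.sum_univ_succ]
  simp only [hup, hup0, contr_apply, Matrix.cons_val_succ, Matrix.cons_val_zero]
  abel

theorem lieDer_smul_left (a : A) (x : L) (μ : Form A L P (n + 1)) (v : Fin (n + 1) → L) :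
    lieDer (a • x) μ v = a • lieDer x μ v +
      ∑ i : Fin (n + 1), (-1 : ℤ) ^ (i : ℕ) • (⁅v i, a⁆ • contr x μ (i.removeNth v)) := by
  have h : ∀ y : L, ⁅a • x, y⁆ = a • ⁅x, y⁆ - ⁅y, a⁆ • x := by
    intro y
    rw [← lie_skew, LieRinehartRing.leibniz_smul_right, ← lie_skew x y, smul_neg]
    abel
  have hi : ∀ (i : Fin (n + 1)) , μ (Function.update v i x) =
      (-1 : ℤ) ^ (i : ℕ) • contr x μ (i.removeNth v) := by
    intro i
    rw [← Fin.insertNth_removeNth, AlternatingMap.map_insertNth]; rfl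
  simp only [lieDer_apply, LieRinehartModule.smul_lie', h, AlternatingMap.map_update_sub,
    AlternatingMap.map_update_smul, smul_sub, Finset.sum_sub_distrib, Finset.smul_sum, hi]
  rw [sub_sub_eq_add_sub]
  simp only [smul_comm ((-1 : ℤ) ^ _)]
  abel

theorem lieDer_add_left (x y : L) (μ : Form A L P n) :
    lieDer (x + y) μ = lieDer x μ + lieDer y μ := by
  ext v
  simp only [lieDer_apply, add_lie, AlternatingMap.map_update_add, Finset.sum_add_distrib,
    AlternatingMap.add_apply]
  abel

/-- A linear family of alternating maps `g x` with `g x (x, …) = 0` uncurries to an alternating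
map. -/
theorem exists_uncurry (g : L →ₗ[A] Form A L P (n + 1))
    (hg : ∀ x w, g x (Matrix.vecCons x w) = 0) :
    ∃ om : Form A L P (n + 2), ∀ x v, om (Matrix.vecCons x v) = g x v := by
  let G : L →ₗ[A] MultilinearMap A (fun _ : Fin (n + 1) => L) P :=
    { toFun := fun x => (g x).toMultilinearMap
      map_add' := fun x y => by rw [map_add]; rfl
      map_smul' := fun a x => by rw [map_smul]; rfl }
  let U : MultilinearMap A (fun _ : Fin (n + 2) => L) P := G.uncurryLeft
  have hval : ∀ v : Fin (n + 2) → L, U v =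
      g (v 0) (Fin.tail v) := fun v => rfl
  have hz : ∀ (v : Fin (n + 2) → L) (k : Fin (n + 1)), v 0 = v k.succ → g (v 0) (Fin.tail v) = 0 := by
    intro v k hk
    by_cases hk0 : k = 0
    · subst hk0
      have : Fin.tail v = Matrix.vecCons (v 0) (Fin.tail (Fin.tail v)) := by
        funext j
        refine Fin.cases ?_ (fun j => ?_) j
        · simp [Fin.tail, hk]
        · simp [Fin.tail]
      rw [this]; exact hg _ _
    · have h1 := AlternatingMap.map_swap (g (v 0)) (Fin.tail v) hk0
      have : Fin.tail v ∘ Equiv.swap k 0 = Matrix.vecCons (v 0)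
          (Fin.tail (Fin.tail v ∘ Equiv.swap k 0)) := by
        funext j
        refine Fin.cases ?_ (fun j => ?_) j
        · simp [Fin.tail, hk]
        · simp [Fin.tail]
      rw [this, hg] at h1
      exact neg_eq_zero.mp h1.symm
  refine ⟨{ U with map_eq_zero_of_eq' := ?_ }, fun x v => ?_⟩
  · intro v i j hij hne
    change U v = 0
    rw [hval]
    induction i using Fin.cases with
    | zero =>
      induction j using Fin.cases with
      | zero => exact absurd rfl hne
      | succ j => exact hz v j hij
    | succ i =>
      induction j using Fin.cases with
      | zero => exact hz v i hij.symm
      | succ j =>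
        exact (g (v 0)).map_eq_zero_of_eq _ (i := i) (j := j) hij (fun h => hne (by rw [h]))
  · change U _ = _
    rw [hval]; rfl

/-- The formula defines an alternating `A`-multilinear map. -/
theorem exists_dFun (μ : Form A L P n) : ∃ om : Form A L P (n + 1), ∀ v, om v = dFun μ v := by
  induction n with
  | zero =>
    let g : L →ₗ[A] P :=
      { toFun := fun x => ⁅x, μ ![]⁆
        map_add' := fun x y => by simp
        map_smul' := fun a x => by simp [LieRinehartModule.smul_lie'] }
    refine ⟨AlternatingMap.ofSubsingleton A L P (0 : Fin 1) g, fun v => ?_⟩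
    have hv : v = Matrix.vecCons (v 0) ![] := by
      funext i; fin_cases i; rfl
    conv_rhs => rw [hv, dFun_cons_zero, lieDer_apply]
    simp [g]
  | succ n ih =>
    choose D hD using fun μ : Form A L P n => ih μ
    let g : L →ₗ[A] Form A L P (n + 1) :=
      { toFun := fun x => lieDer x μ - D (contr x μ)
        map_add' := fun x y => by
          have h : contr (x + y) μ = contr x μ + contr y μ := by simp [contr]
          ext v
          simp only [AlternatingMap.sub_apply, AlternatingMap.add_apply, hD, h, dFun_add,
            lieDer_add_left]
          abel
        map_smul' := fun a x => by
          have h : contr (a • x) μ = a • contr x μ := by simp [contr]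
          ext v
          simp only [AlternatingMap.sub_apply, AlternatingMap.smul_apply, hD, h, dFun_smul,
            lieDer_smul_left, RingHom.id_apply, smul_sub]
          abel }
    have hgv : ∀ x v, g x v = dFun μ (Matrix.vecCons x v) := by
      intro x v
      rw [dFun_cons, ← hD]; rfl
    obtain ⟨om, hom⟩ := exists_uncurry g (fun x w => by
      rw [hgv, dFun_cons, lieDer_cons, lie_self]
      have h0 : μ (Matrix.vecCons (0 : L) w) = 0 := by
        rw [← contr_apply]; simp [contr]
      rw [h0, sub_zero]
      cases n with
      | zero => rw [dFun_cons_zero, sub_self]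
      | succ n =>
        have hc : contr x (contr x μ) = 0 := by
          ext u
          rw [contr_apply, contr_apply]
          exact μ.map_eq_zero_of_eq _ (i := 0) (j := 1) (by simp) (by simp)
        rw [dFun_cons, hc, dFun_zero, sub_zero, sub_self])
    refine ⟨om, fun v => ?_⟩
    have hv : v = Matrix.vecCons (v 0) (Fin.tail v) := (Fin.cons_self_tail v).symm
    rw [hv, hom, hgv]

/-- The differential of a form. -/
def differential (μ : Form A L P n) : Form A L P (n + 1) where
  toFun := dFun μ
  map_update_add' := by
    intro _ v i x y
    obtain ⟨om, hom⟩ := exists_dFun μ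
    simp only [← hom, AlternatingMap.map_update_add]
  map_update_smul' := by
    intro _ v i c x
    obtain ⟨om, hom⟩ := exists_dFun μ
    simp only [← hom, AlternatingMap.map_update_smul]
  map_eq_zero_of_eq' := by
    intro v i j hij hne
    obtain ⟨om, hom⟩ := exists_dFun μ
    rw [← hom]
    exact om.map_eq_zero_of_eq v hij hne

theorem differential_apply (μ : Form A L P n) (v : Fin (n + 1) → L) :
    differential μ v = dFun μ v := rfl

variable {B : Type*} [LieRing B] [Module A B] [LieRingModule B A] [LieRinehartRing A B]

/-- Given an anchor `j : L → B`, the `(n+1)`-forms `μ` on `L` such that for some `n`-form `lam` on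
`B` and all `Φ` in the kernel of `j` one has `ι_Φ μ = Φ ∘ j^* lam`. No condition for `0`-forms. -/
def IsVBForm (j : L →ₗ[A] B) : {n : ℕ} → Form A L P n → Prop
  | 0, _ => True
  | n + 1, μ => ∃ lam : B [⋀^Fin n]→ₗ[A] P, ∀ Φ : L, j Φ = 0 →
      ∀ v, contr Φ μ v = ⁅Φ, lam.compLinearMap j v⁆

theorem map_update_eq (η : Form A L P (n + 1)) (v : Fin (n + 1) → L) (i : Fin (n + 1)) (x : L) :
    η (Function.update v i x) = (-1 : ℤ) ^ (i : ℕ) • contr x η (i.removeNth v) := by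
  rw [← Fin.insertNth_removeNth, AlternatingMap.map_insertNth]; rfl

theorem comp_update (j : L →ₗ[A] B) (v : Fin n → L) (i : Fin n) (x : L) :
    (fun k => j (Function.update v i x k)) = Function.update (fun k => j (v k)) i (j x) := by
  funext k
  by_cases h : k = i
  · subst h; simp
  · simp [h]

theorem exists_descend (j : L →ₗ[A] B) (hj : Function.Surjective j) (η : Form A L P n)
    (h : ∀ v i, j (v i) = 0 → η v = 0) :
    ∃ κ : B [⋀^Fin n]→ₗ[A] P, ∀ v, η v = κ.compLinearMap j v := by
  have hcongr : ∀ v w : Fin n → L, (∀ i, j (v i) = j (w i)) → η v = η w := by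
    intro v w hvw
    have : ∀ s : Finset (Fin n), η (s.piecewise w v) = η v := by
      intro s
      induction s using Finset.induction_on with
      | empty => simp
      | insert i s hi ih =>
        rw [Finset.piecewise_insert, ← ih, ← sub_eq_zero]
        have : η (s.piecewise w v) = η (Function.update (s.piecewise w v) i (v i)) := by
          congr 1
          rw [eq_comm, Function.update_eq_self_iff]
          simp [hi]
        rw [this, ← AlternatingMap.map_update_sub]
        apply h _ i
        simp [hvw]
    rw [← this Finset.univ, Finset.piecewise_univ]
  choose s hs using hj
  have hup : ∀ (w : Fin n → B) (i : Fin n) (x : B) (y : L), j y = x →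
      η (fun k => s (Function.update w i x k)) = η (Function.update (fun k => s (w k)) i y) := by
    intro w i x y hxy
    apply hcongr
    intro k
    by_cases hk : k = i
    · subst hk; simp [hs, hxy]
    · simp [hk]
  refine ⟨{ toFun := fun w => η (fun k => s (w k))
            map_update_add' := ?_
            map_update_smul' := ?_
            map_eq_zero_of_eq' := ?_ }, fun v => ?_⟩
  · intro inst w i x y
    obtain rfl := Subsingleton.elim inst (instDecidableEqFin n)
    rw [hup w i (x + y) (s x + s y) (by simp [hs]), hup w i x (s x) (hs x), hup w i y (s y) (hs y),
      AlternatingMap.map_update_add]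
  · intro inst w i c x
    obtain rfl := Subsingleton.elim inst (instDecidableEqFin n)
    rw [hup w i (c • x) (c • s x) (by simp [hs]), hup w i x (s x) (hs x),
      AlternatingMap.map_update_smul]
  · intro w i k hik hne
    exact η.map_eq_zero_of_eq _ (i := i) (j := k) (by simp [hik]) hne
  · exact hcongr _ _ (fun i => by simp [hs])

theorem IsVBForm.add {j : L →ₗ[A] B} : ∀ {n : ℕ} {μ ν : Form A L P n}, IsVBForm j μ →
    IsVBForm j ν → IsVBForm j (μ + ν)
  | 0, _, _, _, _ => trivial
  | n + 1, μ, ν, ⟨l, hl⟩, ⟨m, hm⟩ => ⟨l + m, fun Φ hΦ v => by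
      have : contr Φ (μ + ν) v = contr Φ μ v + contr Φ ν v := rfl
      rw [this, hl Φ hΦ, hm Φ hΦ, ← lie_add]; rfl⟩

theorem IsVBForm.zero {j : L →ₗ[A] B} : ∀ {n : ℕ}, IsVBForm j (0 : Form A L P n)
  | 0 => trivial
  | n + 1 => ⟨0, fun Φ _ v => by
      have h1 : contr Φ (0 : Form A L P (n + 1)) v = 0 := rfl
      have h2 : (0 : B [⋀^Fin n]→ₗ[A] P).compLinearMap j v = 0 := rfl
      rw [h1, h2, lie_zero]⟩

theorem IsVBForm.smul {j : L →ₗ[A] B} (hj : ∀ x (a : A), ⁅x, a⁆ = ⁅j x, a⁆) :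
    ∀ {n : ℕ} (a : A) {μ : Form A L P n}, IsVBForm j μ → IsVBForm j (a • μ)
  | 0, _, _, _ => trivial
  | n + 1, a, μ, ⟨l, hl⟩ => ⟨a • l, fun Φ hΦ v => by
      have h1 : contr Φ (a • μ) v = a • contr Φ μ v := rfl
      have h2 : (a • l).compLinearMap j v = a • l.compLinearMap j v := rfl
      rw [h1, h2, hl Φ hΦ, LieRinehartModule.lie_smul', hj, hΦ, zero_lie, zero_smul, zero_add]⟩

theorem IsVBForm.contr {j : L →ₗ[A] B} (y : L) : ∀ {n : ℕ} {μ : Form A L P (n + 1)},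
    IsVBForm j μ → IsVBForm j (OmniLie.contr y μ)
  | 0, _, _ => trivial
  | n + 1, μ, ⟨l, hl⟩ => ⟨-l.curryLeft (j y), fun Φ hΦ v => by
      have h1 : OmniLie.contr Φ (OmniLie.contr y μ) v =
          - OmniLie.contr Φ μ (Matrix.vecCons y v) := by
        have := μ.map_swap (Matrix.vecCons Φ (Matrix.vecCons y v))
          (i := 0) (j := 1) (by simp)
        simp only [contr_apply]
        rw [← this]
        congr 1
        funext k
        refine Fin.cases (by simp) (fun k => Fin.cases (by simp) (fun k => ?_) k) k
        rw [Function.comp, Equiv.swap_apply_of_ne_of_ne (by simp [Fin.ext_iff])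
          (by simp [Fin.ext_iff])]
        simp
      have h2 : (-l.curryLeft (j y)).compLinearMap j v =
          - l.compLinearMap j (Matrix.vecCons y v) := by
        change -(l (Matrix.vecCons (j y) (fun k => j (v k)))) =
          -(l (fun k => j (Matrix.vecCons y v k)))
        congr 2
        funext k
        refine Fin.cases (by simp) (fun k => by simp) k
      rw [h1, h2, hl Φ hΦ, lie_neg]⟩

theorem IsVBForm.lieDer {j : L →ₗ[A] B} (hj : ∀ x (a : A), ⁅x, a⁆ = ⁅j x, a⁆)
    (hjl : ∀ x y, j ⁅x, y⁆ = ⁅j x, j y⁆) (x : L) : ∀ {n : ℕ} {μ : Form A L P n},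
    IsVBForm j μ → IsVBForm j (OmniLie.lieDer x μ)
  | 0, _, _ => trivial
  | n + 1, μ, ⟨l, hl⟩ => by
      obtain ⟨m, hm⟩ : ∃ m : B [⋀^Fin n]→ₗ[A] P, ∀ w, m w =
          ⁅x, l w⁆ - ∑ i, l (Function.update w i ⁅j x, w i⁆) :=
        ⟨derAlong (fun a => ⁅x, a⁆) (AddMonoidHom.mk' (fun y => ⁅j x, y⁆) (lie_add (j x)))
          (AddMonoidHom.mk' (fun p => ⁅x, p⁆) (lie_add x))
          (fun a y => by simp [add_comm, hj])
          (fun a p => LieRinehartModule.lie_smul' x a p) l, fun w => rfl⟩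
      refine ⟨m, fun Φ hΦ v => ?_⟩
      have h0 : j ⁅x, Φ⁆ = 0 := by rw [hjl, hΦ, lie_zero]
      have hc : ∀ (w) (l : B [⋀^Fin n]→ₗ[A] P), l.compLinearMap j w = l (fun k => j (w k)) :=
        fun w l => rfl
      rw [contr_apply, lieDer_cons, ← contr_apply, hl _ h0, lieDer_apply, hl Φ hΦ]
      simp only [hl Φ hΦ, hc, comp_update, hjl, hm]
      rw [leibniz_lie, lie_sub, lie_sum]
      abel

theorem IsVBForm.differential {j : L →ₗ[A] B}
    (hjl : ∀ x y, j ⁅x, y⁆ = ⁅j x, j y⁆) (hs : Function.Surjective j) :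
    ∀ {n : ℕ} {μ : Form A L P n}, IsVBForm j μ → IsVBForm j (OmniLie.differential μ)
  | 0, μ, _ => ⟨AlternatingMap.constOfIsEmpty A B (Fin 0) (μ ![]), fun Φ hΦ v => by
      rw [contr_apply, differential_apply, dFun_cons_zero, lieDer_apply]
      simp [Subsingleton.elim v ![]]⟩
  | n + 1, μ, ⟨l, hl⟩ => by
      have hθ : ∀ (v : Fin n → L) i, j (v i) = 0 → l.compLinearMap j v = 0 := by
        intro v i hi
        exact l.map_coord_zero i hi
      have hμ : ∀ Φ, j Φ = 0 → ∀ v, OmniLie.contr Φ μ v = ⁅Φ, l.compLinearMap j v⁆ := hl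
      generalize l.compLinearMap j = θ at hθ hμ
      have hη : ∀ v i, j (v i) = 0 → (μ - OmniLie.differential θ) v = 0 := by
        intro v i hi
        have h1 : ∀ Φ, j Φ = 0 → ∀ w, OmniLie.contr Φ (μ - OmniLie.differential θ) w = 0 := by
          intro Φ hΦ w
          have h2 : OmniLie.contr Φ (μ - OmniLie.differential θ) w =
            OmniLie.contr Φ μ w - dFun θ (Matrix.vecCons Φ w) := rfl
          have h3 : OmniLie.lieDer Φ θ w = ⁅Φ, θ w⁆ := by
            rw [lieDer_apply, sub_eq_self]
            apply Finset.sum_eq_zero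
            intro i _
            exact hθ _ i (by simp [hjl, hΦ])
          rw [h2, hμ Φ hΦ, sub_eq_zero, ← h3]
          cases n with
          | zero => rw [dFun_cons_zero]
          | succ n =>
            have h4 : OmniLie.contr Φ θ = 0 := by
              ext u
              exact hθ _ 0 (by simpa using hΦ)
            rw [dFun_cons, h4, dFun_zero, sub_zero]
        rw [← Function.update_eq_self i v, map_update_eq, h1 _ hi, smul_zero]
      obtain ⟨κ, hκ⟩ := exists_descend j hs _ hη
      refine ⟨κ, fun Φ hΦ v => ?_⟩
      rw [← hκ, contr_apply, differential_apply, dFun_cons]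
      have e1 : OmniLie.lieDer Φ μ v = ⁅Φ, μ v⁆ -
          ∑ i : Fin (n + 1), (-1 : ℤ) ^ (i : ℕ) • ⁅⁅Φ, v i⁆, θ (i.removeNth v)⁆ := by
        rw [lieDer_apply]
        congr 1
        refine Finset.sum_congr rfl fun i _ => ?_
        rw [map_update_eq, hμ _ (by rw [hjl, hΦ, zero_lie])]
      have e2 : dFun (OmniLie.contr Φ μ) v = ⁅Φ, dFun θ v⁆ -
          ∑ i : Fin (n + 1), (-1 : ℤ) ^ (i : ℕ) • ⁅⁅Φ, v i⁆, θ (i.removeNth v)⁆ := by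
        rw [dFun_eq, dFun_eq, lie_sum, ← Finset.sum_sub_distrib]
        refine Finset.sum_congr rfl fun i _ => ?_
        simp only [hμ Φ hΦ]
        rw [lie_zsmul, ← smul_sub, lie_sub, lie_sum, leibniz_lie (v i) Φ, ← lie_skew Φ (v i),
          neg_lie]
        have hif : ∀ (c : Prop) [Decidable c] (p : P), ⁅Φ, (if c then p else 0)⁆ =
          if c then ⁅Φ, p⁆ else 0 := by intro c _ p; split_ifs <;> simp
        simp only [hif]
        congr 1
        abel
      have e3 : (μ - OmniLie.differential θ) v = μ v - dFun θ v := rfl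
      rw [e1, e2, e3, lie_sub]
      abel

end Cartan


/-! ### Smooth functions, vector fields, sections and the gauge algebroid -/

section Geometry

theorem ofNat_le_infty (k : ℕ) : (k : WithTop ℕ∞) ≤ ∞ :=
  WithTop.coe_le_coe.mpr (le_top : (k : ℕ∞) ≤ ⊤)

variable {EB : Type*} [NormedAddCommGroup EB] [NormedSpace ℝ EB] [FiniteDimensional ℝ EB]
  {H : Type*} [TopologicalSpace H] (I : ModelWithCorners ℝ EB H)
  (M : Type*) [TopologicalSpace M] [ChartedSpace H M] [IsManifold I ∞ M]
  [T2Space M] [SigmaCompactSpace M]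

/-- The ring `C^∞(M)`. -/
abbrev SmoothFun : Type _ := C^∞⟮I, M; 𝓘(ℝ, ℝ), ℝ⟯

/-- The module `𝔛(M)` of smooth vector fields. -/
abbrev VField : Type _ := Cₛ^∞⟮I; EB, (TangentSpace I : M → Type _)⟯

variable {M}
variable (F : Type*) [NormedAddCommGroup F] [NormedSpace ℝ F]
  (V : M → Type*) [TopologicalSpace (Bundle.TotalSpace F V)] [∀ x, AddCommGroup (V x)]
  [∀ x, Module ℝ (V x)] [∀ x, TopologicalSpace (V x)] [FiberBundle F V] [VectorBundle ℝ F V]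

/-- The module `Γ(E)` of smooth sections of the vector bundle `E` (with fibres `V x`). -/
abbrev Sec : Type _ := Cₛ^∞⟮I; F, V⟯

variable {I F V}

noncomputable instance instSMulSmoothFunSection : SMul (SmoothFun I M) Cₛ^∞⟮I; F, V⟯ :=
  ⟨fun f s => ⟨fun x => f x • s x, f.contMDiff.smul_section s.contMDiff⟩⟩

theorem smoothFun_smul_apply (f : SmoothFun I M) (s : Cₛ^∞⟮I; F, V⟯) (x : M) :
    (f • s) x = f x • s x := rfl

noncomputable instance instModuleSmoothFunSection : Module (SmoothFun I M) Cₛ^∞⟮I; F, V⟯ where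
  one_smul s := by ext x; exact one_smul ℝ (s x)
  mul_smul f g s := by ext x; exact mul_smul (f x) (g x) (s x)
  smul_zero f := by ext x; exact smul_zero (f x)
  smul_add f s t := by ext x; exact smul_add (f x) (s x) (t x)
  add_smul f g s := by ext x; exact add_smul (f x) (g x) (s x)
  zero_smul s := by ext x; exact zero_smul ℝ (s x)

instance instIsScalarTowerSection : IsScalarTower ℝ (SmoothFun I M) Cₛ^∞⟮I; F, V⟯ :=
  ⟨fun c f s => by ext x; exact smul_assoc c (f x) (s x)⟩

instance instSMulCommClassSection : SMulCommClass ℝ (SmoothFun I M) Cₛ^∞⟮I; F, V⟯ :=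
  ⟨fun c f s => by ext x; exact smul_comm c (f x) (s x)⟩

instance instSMulCommClassSection' : SMulCommClass (SmoothFun I M) ℝ Cₛ^∞⟮I; F, V⟯ :=
  ⟨fun f c s => by ext x; exact smul_comm (f x) c (s x)⟩

/-- The derivative of a smooth vector-valued function along a smooth vector field is smooth. -/
theorem contMDiffOn_mvfderiv {F : Type*} [NormedAddCommGroup F] [NormedSpace ℝ F]
    (X : VField I M) {g : M → F} {U : Set M} (hU : IsOpen U)
    (hg : ContMDiffOn I 𝓘(ℝ, F) ∞ g U) :
    ContMDiffOn I 𝓘(ℝ, F) ∞ (fun x => mvfderiv I g x (X x)) U := by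
  have h1 := hg.contMDiffOn_tangentMapWithin (m := ∞) (by simp) hU.uniqueMDiffOn
  have h2 : ContMDiffOn I I.tangent ∞ (fun x => (⟨x, X x⟩ : TangentBundle I M)) U :=
    X.contMDiff.contMDiffOn
  have h3 := (contMDiff_snd_tangentBundle_modelSpace F 𝓘(ℝ, F) (n := ∞)).comp_contMDiffOn
    (h1.comp h2 (fun x hx => hx))
  refine h3.congr fun x hx => ?_
  simp only [mvfderiv, Function.comp, tangentMapWithin, mfderivWithin_of_isOpen hU hx]
  rfl

/-- Through every vector in a fibre there is a global smooth section. -/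
theorem exists_section_eq [ContMDiffVectorBundle ∞ F V I] (x : M) (v : V x) :
    ∃ s : Cₛ^∞⟮I; F, V⟯, s x = v := by
  classical
  obtain ⟨s, hs⟩ := exists_contMDiffSection_forall_mem_convex_of_local (I := I) (n := ⊤) V
    (fun y => {w | ∀ h : x = y, w = h ▸ v}) (fun y => by
      by_cases h : x = y
      · subst h
        simp
      · simp [h, convex_univ])
    (fun y => by
      by_cases h : x = y
      · subst h
        obtain ⟨U, hU, hs⟩ := FiberBundle.exists_contMDiffOn_extend (k := ∞) I F v
        refine ⟨U, hU, FiberBundle.extend F v, hs, fun z _ h => ?_⟩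
        subst h; simp
      · refine ⟨{x}ᶜ, isOpen_compl_singleton.mem_nhds (Ne.symm h), 0, ?_, fun z hz h => ?_⟩
        · exact (Bundle.contMDiff_zeroSection ℝ V).contMDiffOn
        · exact absurd h.symm hz)
  exact ⟨s, hs x rfl⟩

/-- The Lie derivative `X f = df(X)` of a smooth function. -/
noncomputable def dirDeriv (X : VField I M) (f : SmoothFun I M) : SmoothFun I M :=
  ⟨fun x => mvfderiv I f x (X x), contMDiffOn_univ.mp
    (contMDiffOn_mvfderiv X isOpen_univ f.contMDiff.contMDiffOn)⟩

/-- The Lie bracket of smooth vector fields. -/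
noncomputable instance instBracketVField : Bracket (VField I M) (VField I M) :=
  ⟨fun X Y => ⟨VectorField.mlieBracket I X Y, by
    have : CompleteSpace EB := FiniteDimensional.complete ℝ EB
    have : IsManifold I ((⊤ : ℕ∞) + 1) M := IsManifold.of_le (n := ∞) (by simp)
    have : IsManifold I (minSmoothness ℝ 2) M := IsManifold.of_le (n := ∞)
      (by simpa using ofNat_le_infty 2)
    exact ContDiff.mlieBracket_vectorField (m := ⊤) (n := ⊤) X.contMDiff Y.contMDiff (by simp)⟩⟩

theorem vfield_mdiff (X : VField I M) (x : M) :
    MDifferentiableAt I I.tangent (fun x => (⟨x, X x⟩ : TangentBundle I M)) x :=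
  (X.contMDiff x).mdifferentiableAt (by simp)

theorem smoothFun_mdiff (f : SmoothFun I M) (x : M) : MDifferentiableAt I 𝓘(ℝ, ℝ) f x :=
  (f.contMDiff x).mdifferentiableAt (by simp)

noncomputable instance instLieRingVField : LieRing (VField I M) where
  add_lie X Y Z := by
    have : CompleteSpace EB := FiniteDimensional.complete ℝ EB
    ext x
    exact VectorField.mlieBracket_add_left (vfield_mdiff X x) (vfield_mdiff Y x)
  lie_add X Y Z := by
    have : CompleteSpace EB := FiniteDimensional.complete ℝ EB
    ext x
    exact VectorField.mlieBracket_add_right (vfield_mdiff Y x) (vfield_mdiff Z x)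
  lie_self X := by
    ext x
    exact congrFun VectorField.mlieBracket_self x
  leibniz_lie X Y Z := by
    have : CompleteSpace EB := FiniteDimensional.complete ℝ EB
    have : IsManifold I (minSmoothness ℝ 3) M :=
      IsManifold.of_le (n := ∞) (by simpa using ofNat_le_infty 3)
    have h : ∀ X : VField I M, ContMDiff I I.tangent (minSmoothness ℝ 2)
        (fun x => (⟨x, X x⟩ : TangentBundle I M)) := fun X =>
      X.contMDiff.of_le
        (by simpa using ofNat_le_infty 2)
    ext x
    exact VectorField.leibniz_identity_mlieBracket_apply (h X x) (h Y x) (h Z x)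

theorem vfield_leibniz (X Y : VField I M) (f : SmoothFun I M) :
    ⁅X, f • Y⁆ = f • ⁅X, Y⁆ + dirDeriv X f • Y := by
  have : CompleteSpace EB := FiniteDimensional.complete ℝ EB
  ext x
  refine (VectorField.mlieBracket_smul_right (smoothFun_mdiff f x) (vfield_mdiff Y x)).trans ?_
  exact add_comm _ _

theorem dirDeriv_add (X : VField I M) (f g : SmoothFun I M) :
    dirDeriv X (f + g) = dirDeriv X f + dirDeriv X g := by
  ext x
  change mvfderiv I (⇑f + ⇑g) x (X x) = _
  rw [mvfderiv_add (smoothFun_mdiff f x) (smoothFun_mdiff g x)]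
  rfl

theorem dirDeriv_mul (X : VField I M) (f g : SmoothFun I M) :
    dirDeriv X (f * g) = f • dirDeriv X g + dirDeriv X f * g := by
  ext x
  change mvfderiv I (⇑f * ⇑g) x (X x) = f x * mvfderiv I g x (X x) + mvfderiv I f x (X x) * g x
  rw [mvfderiv_mul (smoothFun_mdiff f x) (smoothFun_mdiff g x)]
  simp [mul_comm]

theorem dirDeriv_lie (X Y : VField I M) (f : SmoothFun I M) :
    dirDeriv ⁅X, Y⁆ f = dirDeriv X (dirDeriv Y f) - dirDeriv Y (dirDeriv X f) := by
  have key : ∀ Z : VField I M, dirDeriv ⁅X, Y⁆ f • Z =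
      (dirDeriv X (dirDeriv Y f) - dirDeriv Y (dirDeriv X f)) • Z := by
    intro Z
    have h1 := leibniz_lie X Y (f • Z)
    simp only [vfield_leibniz, lie_add] at h1
    rw [leibniz_lie X Y Z, smul_add] at h1
    rw [sub_smul]
    rw [← sub_eq_zero] at h1 ⊢
    rw [← neg_eq_zero, ← h1]
    abel
  have : ContMDiffVectorBundle ∞ EB (TangentSpace I : M → Type _) I := by
    have : IsManifold I (∞ + 1) M := IsManifold.of_le (n := ∞) (by simp)
    infer_instance
  ext x
  by_cases h : Subsingleton (TangentSpace I x)
  · change mvfderiv I f x _ = mvfderiv I _ x (X x) - mvfderiv I _ x (Y x)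
    rw [Subsingleton.elim (⁅X, Y⁆ x) 0, Subsingleton.elim (X x) 0, Subsingleton.elim (Y x) 0]
    simp
  · rw [not_subsingleton_iff_nontrivial] at h
    obtain ⟨v, hv⟩ := exists_ne (0 : TangentSpace I x)
    obtain ⟨Z, hZ⟩ := exists_section_eq (I := I) (F := EB) x v
    have := congrArg (fun s : VField I M => s x) (key Z)
    simp only [smoothFun_smul_apply, hZ] at this
    exact smul_left_injective ℝ hv this

noncomputable instance instLieRingModuleVField : LieRingModule (VField I M) (SmoothFun I M) where
  bracket := dirDeriv
  add_lie X Y f := by ext x; exact map_add (mvfderiv I f x) (X x) (Y x)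
  lie_add X f g := dirDeriv_add X f g
  leibniz_lie X Y f := by
    change dirDeriv X (dirDeriv Y f) = dirDeriv ⁅X, Y⁆ f + dirDeriv Y (dirDeriv X f)
    rw [dirDeriv_lie]; abel

theorem vfield_lie_apply (X : VField I M) (f : SmoothFun I M) (x : M) :
    ⁅X, f⁆ x = mvfderiv I f x (X x) := rfl

instance instLieRinehartRingVField : LieRinehartRing (SmoothFun I M) (VField I M) where
  lie_smul_eq_mul' f g X := by ext x; exact map_smul (mvfderiv I g x) (f x) (X x)
  leibniz_mul_right' X f g := dirDeriv_mul X f g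
  leibniz_smul_right' X Y f := vfield_leibniz X Y f

variable (I F V)

/-- The `C^∞(M)`-module `Γ(𝔇E)` of derivations of `E`: `ℝ`-linear operators `D` on `Γ(E)` together
with a vector field `X` (the symbol), such that `D(f u) = X(f) u + f D(u)`. The vector field is
determined by the operator if the fibres are non-zero, see `gauge_ext_of_nontrivial`. -/
noncomputable def gaugeSubmodule :
    Submodule (SmoothFun I M) ((Sec I F V →ₗ[ℝ] Sec I F V) × VField I M) where
  carrier := {p | ∀ (f : SmoothFun I M) (u : Sec I F V), p.1 (f • u) = ⁅p.2, f⁆ • u + f • p.1 u}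
  zero_mem' := fun f u => by simp
  add_mem' := fun {p q} hp hq f u => by
    simp only [Prod.fst_add, Prod.snd_add, LinearMap.add_apply, hp f u, hq f u, add_lie, add_smul,
      smul_add]
    abel
  smul_mem' := fun g p hp f u => by
    simp only [Prod.smul_fst, Prod.smul_snd, LinearMap.smul_apply, hp f u,
      LieRinehartRing.lie_smul_eq_mul, smul_add, mul_smul]
    rw [smul_comm f g]

/-- The module `Γ(𝔇E)` of sections of the gauge algebroid of `E`. -/
abbrev Gauge : Type _ := ↥(gaugeSubmodule I F V)

variable {I F V}

noncomputable instance instFunLikeGauge : CoeFun (Gauge I F V) (fun _ => Sec I F V → Sec I F V) :=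
  ⟨fun D => D.1.1⟩

variable (I F V) in
/-- The anchor `𝕛 : Γ(𝔇E) → 𝔛(M)`, the vector field of a derivation. -/
noncomputable def anchor : Gauge I F V →ₗ[SmoothFun I M] VField I M :=
  (LinearMap.snd _ _ _).comp (gaugeSubmodule I F V).subtype

theorem gauge_leibniz (D : Gauge I F V) (f : SmoothFun I M) (u : Sec I F V) :
    D (f • u) = ⁅anchor I F V D, f⁆ • u + f • D u := D.2 f u

theorem gauge_ext {D D' : Gauge I F V} (h : ∀ u, D u = D' u)
    (h' : anchor I F V D = anchor I F V D') : D = D' :=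
  Subtype.ext (Prod.ext (LinearMap.ext h) h')

/-- The commutator bracket of derivations. -/
noncomputable instance instBracketGauge : Bracket (Gauge I F V) (Gauge I F V) :=
  ⟨fun D D' => ⟨(D.1.1 ∘ₗ D'.1.1 - D'.1.1 ∘ₗ D.1.1, ⁅D.1.2, D'.1.2⁆), fun f u => by
    have h : ∀ f u, D.1.1 (f • u) = ⁅D.1.2, f⁆ • u + f • D.1.1 u := D.2
    have h' : ∀ f u, D'.1.1 (f • u) = ⁅D'.1.2, f⁆ • u + f • D'.1.1 u := D'.2
    simp only [LinearMap.sub_apply, LinearMap.comp_apply, h, h', map_add, smul_sub]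
    rw [lie_lie, sub_smul]
    abel⟩⟩

theorem gauge_lie_apply (D D' : Gauge I F V) (u : Sec I F V) :
    ⁅D, D'⁆ u = D (D' u) - D' (D u) := rfl

theorem anchor_lie (D D' : Gauge I F V) :
    anchor I F V ⁅D, D'⁆ = ⁅anchor I F V D, anchor I F V D'⁆ := rfl

noncomputable instance instLieRingGauge : LieRing (Gauge I F V) where
  add_lie D₁ D₂ D₃ := gauge_ext (fun u => by
      change D₁ (D₃ u) + D₂ (D₃ u) - D₃.1.1 (D₁ u + D₂ u) =
        (D₁ (D₃ u) - D₃ (D₁ u)) + (D₂ (D₃ u) - D₃ (D₂ u))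
      rw [map_add]; abel)
    (add_lie (anchor I F V D₁) (anchor I F V D₂) (anchor I F V D₃))
  lie_add D₁ D₂ D₃ := gauge_ext (fun u => by
      change D₁.1.1 (D₂ u + D₃ u) - (D₂ (D₁ u) + D₃ (D₁ u)) =
        (D₁ (D₂ u) - D₂ (D₁ u)) + (D₁ (D₃ u) - D₃ (D₁ u))
      rw [map_add]; abel)
    (lie_add (anchor I F V D₁) (anchor I F V D₂) (anchor I F V D₃))
  lie_self D := gauge_ext (fun u => sub_self (D (D u))) (lie_self (anchor I F V D))
  leibniz_lie D₁ D₂ D₃ := gauge_ext (fun u => by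
      change D₁.1.1 (D₂ (D₃ u) - D₃ (D₂ u)) - (D₂ (D₃ (D₁ u)) - D₃ (D₂ (D₁ u))) =
        (D₁ (D₂ (D₃ u)) - D₂ (D₁ (D₃ u)) - D₃.1.1 (D₁ (D₂ u) - D₂ (D₁ u))) +
        (D₂.1.1 (D₁ (D₃ u) - D₃ (D₁ u)) - (D₁ (D₃ (D₂ u)) - D₃ (D₁ (D₂ u))))
      simp only [map_sub]; abel)
    (leibniz_lie (anchor I F V D₁) (anchor I F V D₂) (anchor I F V D₃))

/-- The action of derivations on functions through the anchor. -/
noncomputable instance instLieRingModuleGaugeFun :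
    LieRingModule (Gauge I F V) (SmoothFun I M) where
  bracket D f := ⁅anchor I F V D, f⁆
  add_lie D D' f := by rw [map_add]; exact add_lie _ _ _
  lie_add D f g := lie_add (anchor I F V D) f g
  leibniz_lie D D' f := leibniz_lie (anchor I F V D) (anchor I F V D') f

theorem gauge_lie_fun (D : Gauge I F V) (f : SmoothFun I M) : ⁅D, f⁆ = ⁅anchor I F V D, f⁆ := rfl

/-- The tautological action of derivations on sections. -/
noncomputable instance instLieRingModuleGaugeSec : LieRingModule (Gauge I F V) (Sec I F V) where
  bracket D u := D u
  add_lie _ _ _ := rfl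
  lie_add D u v := map_add D.1.1 u v
  leibniz_lie D D' u := by rw [gauge_lie_apply]; abel

theorem gauge_lie_sec (D : Gauge I F V) (u : Sec I F V) : ⁅D, u⁆ = D u := rfl

instance instLieRinehartRingGauge : LieRinehartRing (SmoothFun I M) (Gauge I F V) where
  lie_smul_eq_mul' a b D := by
    rw [gauge_lie_fun, map_smul]; exact LieRinehartRing.lie_smul_eq_mul' a b (anchor I F V D)
  leibniz_mul_right' D a b := LieRinehartRing.leibniz_mul_right' (anchor I F V D) a b
  leibniz_smul_right' D D' a := gauge_ext (fun u => by
      change D (a • D' u) - a • D' (D u) = a • (D (D' u) - D' (D u)) + ⁅anchor I F V D, a⁆ • D' u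
      rw [gauge_leibniz, smul_sub]; abel)
    (LieRinehartRing.leibniz_smul_right' (anchor I F V D) (anchor I F V D') a)

instance instLieRinehartModuleGauge :
    LieRinehartModule (SmoothFun I M) (Gauge I F V) (Sec I F V) where
  lie_smul' D f u := D.2 f u
  smul_lie' _ _ _ := rfl

/-- Surjectivity of the anchor. -/
theorem anchor_surjective [ContMDiffVectorBundle ∞ F V I] :
    Function.Surjective (anchor I F V) := by
  intro X
  let e : M → Bundle.Trivialization F (Bundle.TotalSpace.proj : Bundle.TotalSpace F V → M) :=
    fun i => trivializationAt F V i
  obtain ⟨ρ, hρ⟩ := SmoothPartitionOfUnity.exists_isSubordinate I isClosed_univ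
    (fun i : M => (e i).baseSet) (fun i => (e i).open_baseSet)
    (fun x _ => Set.mem_iUnion.mpr ⟨x, FiberBundle.mem_baseSet_trivializationAt' x⟩)
  -- the local representative of a section and its derivative along `X`
  let loc : M → Sec I F V → M → F := fun i u y => (e i ⟨y, u y⟩).2
  have hloc : ∀ i u, ContMDiffOn I 𝓘(ℝ, F) ∞ (loc i u) (e i).baseSet := fun i u =>
    ((e i).contMDiffOn_section_baseSet_iff).mp u.contMDiff.contMDiffOn
  have hdiff : ∀ i u x, x ∈ (e i).baseSet → MDifferentiableAt I 𝓘(ℝ, F) (loc i u) x :=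
    fun i u x hx => ((hloc i u).contMDiffAt ((e i).open_baseSet.mem_nhds hx)).mdifferentiableAt
      (by simp)
  let D : M → Sec I F V → (x : M) → V x := fun i u x =>
    (e i).symm x (mvfderiv I (loc i u) x (X x))
  have hD : ∀ i u, ContMDiffOn I (I.prod 𝓘(ℝ, F)) ∞
      (fun x => Bundle.TotalSpace.mk' F x (D i u x)) (e i).baseSet := by
    intro i u
    rw [(e i).contMDiffOn_section_baseSet_iff]
    refine (contMDiffOn_mvfderiv X (e i).open_baseSet (hloc i u)).congr fun x hx => ?_
    simp only [D]
    exact (congrArg Prod.snd ((e i).apply_mk_symm hx _))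
  have hcongr : ∀ {g g' : M → F} {x : M}, g =ᶠ[𝓝 x] g' → mvfderiv I g x (X x) =
      mvfderiv I g' x (X x) := fun {g g' x} h => by
    simp only [mvfderiv, ContinuousLinearMap.comp_apply, h.mfderiv_eq]
    rfl
  have hs : ∀ i x, x ∈ (e i).baseSet → ∀ w, (e i).symm x w = (e i).symmₗ ℝ x w :=
    fun i x hx w => ((e i).symmₗ_apply hx w).symm
  have hDadd : ∀ i u v x, x ∈ (e i).baseSet → D i (u + v) x = D i u x + D i v x := by
    intro i u v x hx
    have h : loc i (u + v) =ᶠ[𝓝 x] loc i u + loc i v := by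
      filter_upwards [(e i).open_baseSet.mem_nhds hx] with y hy
      exact ((e i).linear ℝ hy).map_add (u y) (v y)
    simp only [D]
    rw [hcongr h, mvfderiv_add (hdiff i u x hx) (hdiff i v x hx)]
    simp only [hs i x hx]
    exact map_add ((e i).symmₗ ℝ x) _ _
  have hsymm : ∀ i (u : Sec I F V) x, x ∈ (e i).baseSet → (e i).symm x (loc i u x) = u x :=
    fun i u x hx => (e i).symm_apply_apply_mk hx (u x)
  have hDsmul : ∀ i (f : SmoothFun I M) u x, x ∈ (e i).baseSet →
      D i (f • u) x = ⁅X, f⁆ x • u x + f x • D i u x := by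
    intro i f u x hx
    have h : loc i (f • u) =ᶠ[𝓝 x] ⇑f • loc i u := by
      filter_upwards [(e i).open_baseSet.mem_nhds hx] with y hy
      exact ((e i).linear ℝ hy).map_smul (f y) (u y)
    simp only [D]
    rw [hcongr h, mvfderiv_smul (smoothFun_mdiff f x) (hdiff i u x hx), ← hsymm i u x hx]
    have h1 := map_add ((e i).symmₗ ℝ x) (f x • mvfderiv I (loc i u) x (X x))
      (mvfderiv I f x (X x) • loc i u x)
    rw [map_smul, map_smul] at h1
    simp only [hs i x hx]
    exact h1.trans (add_comm _ _)
  have hDconst : ∀ i (c : ℝ) u x, x ∈ (e i).baseSet → D i (c • u) x = c • D i u x := by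
    intro i c u x hx
    let f : SmoothFun I M := ⟨fun _ => c, contMDiff_const⟩
    have h := hDsmul i f u x hx
    have h0 : ⁅X, f⁆ x = 0 := by
      rw [vfield_lie_apply]
      change mvfderiv I (fun _ => c) x (X x) = 0
      rw [mvfderiv_const]; rfl
    rw [h0, zero_smul, zero_add] at h
    exact h
  have hmem : ∀ i x, ρ i x ≠ 0 → x ∈ (e i).baseSet := fun i x hx =>
    hρ i (subset_closure hx)
  have hfin : ∀ (s : M → (x : M) → V x) x, (Function.support fun i => ρ i x • s i x).Finite :=
    fun s x => (ρ.locallyFinite.point_finite x).subset fun i hi => left_ne_zero_of_smul hi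
  let op : Sec I F V → Sec I F V := fun u => ⟨fun x => ∑ᶠ i, ρ i x • D i u x, by
    apply ContMDiff.finsum_section_of_locallyFinite
    · exact ρ.locallyFinite.subset fun i x hx => left_ne_zero_of_smul hx
    · intro i
      exact ContMDiffOn.smul_section_of_tsupport (ρ i).contMDiff.contMDiffOn
        (e i).open_baseSet (hρ i) (hD i u)⟩
  have hop : ∀ u x, op u x = ∑ᶠ i, ρ i x • D i u x := fun u x => rfl
  have hterm : ∀ (s t : M → (x : M) → V x) x, (∀ i, x ∈ (e i).baseSet → s i x = t i x) →
      ∑ᶠ i, ρ i x • s i x = ∑ᶠ i, ρ i x • t i x := by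
    intro s t x h
    refine finsum_congr fun i => ?_
    by_cases h0 : ρ i x = 0
    · simp [h0]
    · rw [h i (hmem i x h0)]
  refine ⟨⟨({ toFun := op, map_add' := fun u v => ?_, map_smul' := fun c u => ?_ }, X),
    fun f u => ?_⟩, rfl⟩
  · ext x
    change op (u + v) x = op u x + op v x
    rw [hop, hop, hop, hterm _ (fun i x => D i u x + D i v x) x (fun i hx => hDadd i u v x hx)]
    simp only [smul_add]
    exact finsum_add_distrib (hfin _ x) (hfin _ x)
  · ext x
    change op (c • u) x = c • op u x
    rw [hop, hop, hterm _ (fun i x => c • D i u x) x (fun i hx => hDconst i c u x hx)]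
    simp only [smul_comm _ c]
    exact (smul_finsum' c (hfin _ x)).symm
  · ext x
    change op (f • u) x = ⁅X, f⁆ x • u x + f x • op u x
    rw [hop, hop, hterm _ (fun i x => ⁅X, f⁆ x • u x + f x • D i u x) x
      (fun i hx => hDsmul i f u x hx)]
    simp only [smul_add]
    rw [finsum_add_distrib (hfin (fun _ x => ⁅X, f⁆ x • u x) x) (hfin (fun i x => f x • D i u x) x)]
    congr 1
    · rw [← finsum_smul, ρ.sum_eq_one (Set.mem_univ x), one_smul]
    · simp only [smul_comm _ (f x)]
      exact (smul_finsum' (f x) (hfin _ x)).symm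

/-- If the fibres are non-trivial, the vector field of a derivation is unique. -/
theorem gauge_ext_of_nontrivial [ContMDiffVectorBundle ∞ F V I] [Nontrivial F]
    {D D' : Gauge I F V} (h : ∀ u, D u = D' u) : D = D' := by
  refine gauge_ext h ?_
  have h1 : ∀ (f : SmoothFun I M) x, ⁅anchor I F V D, f⁆ x = ⁅anchor I F V D', f⁆ x := by
    intro f x
    have : Nontrivial (V x) := (((trivializationAt F V x).linearEquivAt ℝ x
      (FiberBundle.mem_baseSet_trivializationAt' x)).toEquiv).nontrivial
    obtain ⟨v, hv⟩ := exists_ne (0 : V x)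
    obtain ⟨u, hu⟩ := exists_section_eq (I := I) (F := F) x v
    have h2 := congrArg (fun s : Sec I F V => s x) (h (f • u))
    simp only [gauge_leibniz, h u, ContMDiffSection.coe_add, Pi.add_apply, smoothFun_smul_apply,
      hu, add_left_inj] at h2
    exact smul_left_injective ℝ hv h2
  ext x
  have hinv := isInvertible_mfderiv_extChartAt (I := I) (mem_extChartAt_source (I := I) x)
  apply hinv.injective
  rw [← sub_eq_zero]
  by_contra hne
  obtain ⟨φ, hφ⟩ := SeparatingDual.exists_ne_zero (R := ℝ) (V := EB) hne
  let b : SmoothBumpFunction I x := Classical.choice inferInstance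
  let f : SmoothFun I M := ⟨fun y => b y • φ (extChartAt I x y), b.contMDiff_smul
    (φ.contMDiff.comp_contMDiffOn contMDiffOn_extChartAt)⟩
  have hd : ∀ w : TangentSpace I x, mvfderiv I f x w =
      φ (mfderiv I 𝓘(ℝ, EB) (extChartAt I x) x w) := by
    intro w
    have he : ⇑f =ᶠ[𝓝 x] fun y => φ (extChartAt I x y) := by
      filter_upwards [b.eventuallyEq_one] with y hy
      change b y • φ (extChartAt I x y) = _
      rw [hy]; simp
    have hx : MDifferentiableAt I 𝓘(ℝ, EB) (extChartAt I x) x :=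
      (contMDiffAt_extChartAt (n := 1)).mdifferentiableAt one_ne_zero
    have hc := mfderiv_comp (I := I) (I' := 𝓘(ℝ, EB)) (I'' := 𝓘(ℝ, ℝ)) x
      (φ.contMDiff (n := 1) |>.contMDiffAt.mdifferentiableAt one_ne_zero) hx
    have he' : mfderiv I 𝓘(ℝ, ℝ) f x = mfderiv I 𝓘(ℝ, ℝ) (φ ∘ extChartAt I x) x := he.mfderiv_eq
    simp only [mvfderiv, ContinuousLinearMap.comp_apply]
    rw [he', hc, mfderiv_eq_fderiv, ContinuousLinearMap.fderiv]
    rfl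
  apply hφ
  have := h1 f x
  rw [vfield_lie_apply, vfield_lie_apply, hd, hd] at this
  exact (map_sub φ _ _).trans (sub_eq_zero.mpr this)

/-! ### The sections of `𝔍_n E` and the higher omni-Lie algebroid -/

instance instIsScalarTowerForm (n : ℕ) :
    IsScalarTower ℝ (SmoothFun I M) (Form (SmoothFun I M) (Gauge I F V) (Sec I F V) n) :=
  ⟨fun c f μ => AlternatingMap.ext fun v => smul_assoc c f (μ v)⟩

theorem gauge_anchor_lie (D D' : Gauge I F V) :
    anchor I F V ⁅D, D'⁆ = ⁅anchor I F V D, anchor I F V D'⁆ := rfl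

variable (I F V) in
/-- The sections of `𝔍_n E`: the `Γ(E)`-valued `n`-forms `μ` on `Γ(𝔇E)` for which there is, if
`n ≥ 1`, an `E`-valued `(n-1)`-form `lam` on `M` with `ι_Φ μ = Φ ∘ 𝕛^* lam` for all `Φ ∈ ker 𝕛`,
that is, all sections of the bundle of endomorphisms of `E`. For `n = 0` this is `Γ(E)`. -/
noncomputable def vbForms (n : ℕ) :
    Submodule (SmoothFun I M) (Form (SmoothFun I M) (Gauge I F V) (Sec I F V) n) where
  carrier := {μ | IsVBForm (anchor I F V) μ}
  zero_mem' := IsVBForm.zero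
  add_mem' := IsVBForm.add
  smul_mem' a _ h := IsVBForm.smul (A := SmoothFun I M) (L := Gauge I F V) (P := Sec I F V) (B := VField I M)
    gauge_lie_fun a h

noncomputable instance instAddCommGroupVBForms (n : ℕ) : AddCommGroup (vbForms I F V n) :=
  Submodule.addCommGroup _

noncomputable instance instModuleVBForms (n : ℕ) : Module (SmoothFun I M) (vbForms I F V n) :=
  Submodule.module _

noncomputable instance instModuleRealVBForms (n : ℕ) : Module ℝ (vbForms I F V n) :=
  Submodule.module' _

variable {n : ℕ}

/-- The contraction `ι_D μ`, which is also the pairing `⟨μ, D⟩` of `𝔍_{n+1} E` and `𝔇E`. -/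
noncomputable def vbContr (D : Gauge I F V) (μ : vbForms I F V (n + 1)) : vbForms I F V n :=
  ⟨contr D μ.1, IsVBForm.contr D μ.2⟩

/-- The Lie derivative `𝔏_D μ`. -/
noncomputable def vbLieDer (D : Gauge I F V) (μ : vbForms I F V n) : vbForms I F V n :=
  ⟨lieDer D μ.1, IsVBForm.lieDer (A := SmoothFun I M) (L := Gauge I F V) (P := Sec I F V) (B := VField I M)
    (j := anchor I F V) gauge_lie_fun gauge_anchor_lie D μ.2⟩

/-- The differential of sections of `𝔍_n E`. -/
noncomputable def vbDiff [ContMDiffVectorBundle ∞ F V I] (μ : vbForms I F V n) :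
    vbForms I F V (n + 1) :=
  ⟨differential μ.1, IsVBForm.differential (A := SmoothFun I M) (L := Gauge I F V) (P := Sec I F V)
    (B := VField I M) (j := anchor I F V) gauge_anchor_lie anchor_surjective μ.2⟩

variable (I F V) in
/-- The sections of `𝔇E ⊕ 𝔍_n E`. -/
abbrev OmniSec (n : ℕ) : Type _ := Gauge I F V × vbForms I F V n

/-- The projection `ρ` onto the first summand. -/
noncomputable def rho (e : OmniSec I F V n) : Gauge I F V := e.1

/-- The higher Dorfman bracket
`{D + μ, R + ν} = [D, R] + 𝔏_D ν - 𝔏_R μ + d ⟨μ, R⟩`. -/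
noncomputable def dorfman [ContMDiffVectorBundle ∞ F V I] (e₁ e₂ : OmniSec I F V (n + 1)) :
    OmniSec I F V (n + 1) :=
  (⁅e₁.1, e₂.1⁆, vbLieDer e₁.1 e₂.2 - vbLieDer e₂.1 e₁.2 + vbDiff (vbContr e₂.1 e₁.2))

/-- The pairing `(D + μ, R + ν)_+ = (⟨ν, D⟩ + ⟨μ, R⟩) / 2` with values in `Γ(𝔍_n E)`. -/
noncomputable def pairing (e₁ e₂ : OmniSec I F V (n + 1)) : vbForms I F V n :=
  (1 / 2 : ℝ) • (vbContr e₁.1 e₂.2 + vbContr e₂.1 e₁.2)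

/-- The bilinear bracket `br` makes the `R`-module `L` a (left) Leibniz algebra. -/
structure IsLeibnizAlgebra (R L : Type*) [CommRing R] [AddCommGroup L] [Module R L]
    (br : L → L → L) : Prop where
  add_left : ∀ x y z, br (x + y) z = br x z + br y z
  add_right : ∀ x y z, br x (y + z) = br x y + br x z
  smul_left : ∀ (c : R) x y, br (c • x) y = c • br x y
  smul_right : ∀ (c : R) x y, br x (c • y) = c • br x y
  leibniz : ∀ x y z, br x (br y z) = br (br x y) z + br y (br x z)

end Geometry
end OmniLie

/-!
The five identities are consequences of the Cartan calculus of `P`-valued forms on a Lie-Rinehart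
algebra `L`, applied to `L = Γ(𝔇E)` and `P = Γ(E)`. Since a form of positive degree is determined
by its contractions (`form_ext`), the Cartan relations

* `ι_y 𝔏_x = 𝔏_x ι_y - ι_[x, y]` (`contr_lieDer`),
* `ι_x d = 𝔏_x - d ι_x` (`contr_differential`),
* `𝔏_[x, y] = 𝔏_x 𝔏_y - 𝔏_y 𝔏_x` (`lieDer_lie`),
* `𝔏_x d = d 𝔏_x` (`lieDer_differential`),
* `d d = 0` (`differential_differential`)

follow by induction on the degree: the first two come straight from the formulas for `𝔏` and `d`,
and each of the others, contracted with an element of `L`, reduces by the relations above it to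
itself in lower degree.

In the Leibniz identity, the terms that contain the form of the second or third argument agree by
the commutation relations alone; those with the form of the first argument need in addition
`𝔏_x d = d ι_x d`, which is Cartan's formula with `d d = 0` (`differential_contr_differential`). In
the Leibniz rule for `f • e₂`, the terms `df ∧ ι_R μ` coming from `𝔏_{f R} μ` and from
`d (f ι_R μ)` cancel. Homogeneity over `ℝ` is the same computation for the constant functions,
which all derivations annihilate. In the invariance of the pairing, the terms not accounted for
by the first relation are those in which the form of the first argument is contracted with the
other two; they cancel by Cartan's formula and the antisymmetry of forms
(`contr_differential_contr_add`).
-/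

namespace OmniLie

/-! ### Contractions -/

section Contraction

variable {A L P : Type*} [CommRing A] [AddCommGroup P] [Module A P] [LieRing L] [Module A L]
  {n : ℕ}

/-- A form of positive degree is determined by its contractions. -/
theorem form_ext {μ ν : Form A L P (n + 1)} (h : ∀ x, contr x μ = contr x ν) : μ = ν := by
  ext v
  rw [← Matrix.cons_head_tail v]
  exact congrArg (fun η : Form A L P n => η (Matrix.vecTail v)) (h (Matrix.vecHead v))

theorem contr_add (x : L) (μ ν : Form A L P (n + 1)) :
    contr x (μ + ν) = contr x μ + contr x ν := rfl

theorem contr_sub (x : L) (μ ν : Form A L P (n + 1)) :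
    contr x (μ - ν) = contr x μ - contr x ν := rfl

theorem contr_smul (a : A) (x : L) (μ : Form A L P (n + 1)) :
    contr x (a • μ) = a • contr x μ := rfl

theorem contr_add_left (x y : L) (μ : Form A L P (n + 1)) :
    contr (x + y) μ = contr x μ + contr y μ := by
  simp [contr]

theorem contr_smul_left (a : A) (x : L) (μ : Form A L P (n + 1)) :
    contr (a • x) μ = a • contr x μ := by
  simp [contr]

theorem contr_neg_left (x : L) (μ : Form A L P (n + 1)) : contr (-x) μ = -contr x μ := by
  simp [contr]

theorem contr_contr_self (x : L) (μ : Form A L P (n + 2)) : contr x (contr x μ) = 0 :=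
  AlternatingMap.ext fun v =>
    μ.map_eq_zero_of_eq (Matrix.vecCons x (Matrix.vecCons x v)) (i := 0) (j := 1) rfl (by simp)

theorem contr_contr_skew (x y : L) (μ : Form A L P (n + 2)) :
    contr x (contr y μ) = -contr y (contr x μ) := by
  have h := contr_contr_self (x + y) μ
  simp only [contr_add_left, contr_add, contr_contr_self, zero_add, add_zero] at h
  exact eq_neg_of_add_eq_zero_right h

end Contraction

/-! ### Cartan relations -/

section CartanRelations

variable {A L P : Type*} [CommRing A] [AddCommGroup P] [Module A P]
  [LieRing L] [Module A L] [LieRingModule L A] [LieRinehartRing A L]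
  [LieRingModule L P] [LieRinehartModule A L P] {n : ℕ}

theorem lieDer_add (x : L) (μ ν : Form A L P n) :
    lieDer x (μ + ν) = lieDer x μ + lieDer x ν := by
  ext v
  simp only [lieDer_apply, AlternatingMap.add_apply, lie_add, Finset.sum_add_distrib]
  abel

theorem lieDer_sub (x : L) (μ ν : Form A L P n) :
    lieDer x (μ - ν) = lieDer x μ - lieDer x ν :=
  map_sub (AddMonoidHom.mk' (lieDer x) (lieDer_add x)) μ ν

theorem lieDer_smul (x : L) (a : A) (μ : Form A L P n) :
    lieDer x (a • μ) = a • lieDer x μ + ⁅x, a⁆ • μ := by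
  ext v
  simp only [lieDer_apply, AlternatingMap.smul_apply, AlternatingMap.add_apply,
    LieRinehartModule.lie_smul', smul_sub, Finset.smul_sum]
  abel

theorem differential_add (μ ν : Form A L P n) :
    differential (μ + ν) = differential μ + differential ν :=
  AlternatingMap.ext (dFun_add μ ν)

theorem differential_sub (μ ν : Form A L P n) :
    differential (μ - ν) = differential μ - differential ν :=
  map_sub (AddMonoidHom.mk' (differential (n := n)) differential_add) μ ν

theorem differential_zero : differential (0 : Form A L P n) = 0 :=
  AlternatingMap.ext dFun_zero

theorem contr_lieDer (x y : L) (μ : Form A L P (n + 1)) :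
    contr y (lieDer x μ) = lieDer x (contr y μ) - contr ⁅x, y⁆ μ :=
  AlternatingMap.ext (lieDer_cons x y μ)

theorem contr_differential_zero (x : L) (μ : Form A L P 0) :
    contr x (differential μ) = lieDer x μ :=
  AlternatingMap.ext (dFun_cons_zero μ x)

/-- Cartan's formula `ι_x d = 𝔏_x - d ι_x`, in positive degree. -/
theorem contr_differential (x : L) (μ : Form A L P (n + 1)) :
    contr x (differential μ) = lieDer x μ - differential (contr x μ) :=
  AlternatingMap.ext (dFun_cons μ x)

theorem lieDer_lie (x y : L) (μ : Form A L P n) :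
    lieDer ⁅x, y⁆ μ = lieDer x (lieDer y μ) - lieDer y (lieDer x μ) := by
  induction n with
  | zero =>
    ext v
    simp [lieDer_apply]
  | succ n ih =>
    refine form_ext fun z => ?_
    simp only [contr_sub, contr_lieDer, lieDer_sub, ih]
    rw [lie_lie x y z, sub_eq_add_neg ⁅x, ⁅y, z⁆⁆, contr_add_left,
      contr_neg_left]
    abel

theorem lieDer_differential (x : L) (μ : Form A L P n) :
    lieDer x (differential μ) = differential (lieDer x μ) := by
  induction n with
  | zero =>
    refine form_ext fun y => ?_
    simp only [contr_lieDer, contr_differential_zero, lieDer_lie]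
    abel
  | succ n ih =>
    refine form_ext fun y => ?_
    simp only [contr_lieDer, contr_differential, lieDer_lie, lieDer_sub, differential_sub, ih]
    abel

theorem differential_differential (μ : Form A L P n) : differential (differential μ) = 0 := by
  induction n with
  | zero =>
    refine form_ext fun x => ?_
    rw [contr_differential, contr_differential_zero, lieDer_differential, sub_self]
    rfl
  | succ n ih =>
    refine form_ext fun x => ?_
    rw [contr_differential, contr_differential, differential_sub, ih, sub_zero,
      lieDer_differential, sub_self]
    rfl

theorem differential_contr_differential (x : L) (μ : Form A L P n) :
    differential (contr x (differential μ)) = lieDer x (differential μ) := by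
  cases n with
  | zero => rw [contr_differential_zero, lieDer_differential]
  | succ n =>
    rw [contr_differential, differential_sub, differential_differential, sub_zero,
      lieDer_differential]

/-- The symmetrization of `ι_x d ι_y μ` in `x` and `y`: the terms `d ι_x ι_y μ` in Cartan's formula
cancel. -/
theorem contr_differential_contr_add (x y : L) (μ : Form A L P (n + 1)) :
    contr x (differential (contr y μ)) + contr y (differential (contr x μ)) =
      lieDer x (contr y μ) + lieDer y (contr x μ) := by
  cases n with
  | zero => rw [contr_differential_zero, contr_differential_zero]
  | succ n =>
    rw [contr_differential, contr_differential, sub_add_sub_comm, ← differential_add,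
      contr_contr_skew x y, neg_add_cancel, differential_zero, sub_zero]

/-- The terms `da ∧ ι_x μ` in `𝔏_{a x} μ` and in `d (a ι_x μ)` cancel. -/
theorem differential_smul_contr_sub_lieDer_smul (a : A) (x : L) (μ : Form A L P (n + 1)) :
    differential (a • contr x μ) - lieDer (a • x) μ =
      a • (differential (contr x μ) - lieDer x μ) := by
  ext v
  simp only [AlternatingMap.sub_apply, AlternatingMap.smul_apply, differential_apply, dFun_smul,
    lieDer_smul_left, smul_sub]
  abel

theorem differential_smul_of_lie_eq_zero {a : A} (ha : ∀ x : L, ⁅x, a⁆ = 0) (μ : Form A L P n) :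
    differential (a • μ) = a • differential μ := by
  ext v
  simp [differential_apply, dFun_smul, ha]

theorem lieDer_smul_left_of_lie_eq_zero {a : A} (ha : ∀ x : L, ⁅x, a⁆ = 0) (x : L)
    (μ : Form A L P (n + 1)) : lieDer (a • x) μ = a • lieDer x μ := by
  ext v
  simp [lieDer_smul_left, ha]

theorem smul_lie_of_lie_eq_zero {a : A} (ha : ∀ x : L, ⁅x, a⁆ = 0) (x y : L) :
    ⁅a • x, y⁆ = a • ⁅x, y⁆ := by
  rw [← lie_skew, LieRinehartRing.leibniz_smul_right, ha, zero_smul, add_zero, ← smul_neg,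
    lie_skew]

end CartanRelations

/-! ### The higher Dorfman bracket -/

section Dorfman

variable {EB : Type*} [NormedAddCommGroup EB] [NormedSpace ℝ EB] [FiniteDimensional ℝ EB]
  {H : Type*} [TopologicalSpace H] {I : ModelWithCorners ℝ EB H}
  {M : Type*} [TopologicalSpace M] [ChartedSpace H M] [IsManifold I ∞ M]
  [T2Space M] [SigmaCompactSpace M]
  {F : Type*} [NormedAddCommGroup F] [NormedSpace ℝ F]
  {V : M → Type*} [TopologicalSpace (Bundle.TotalSpace F V)] [∀ x, AddCommGroup (V x)]
  [∀ x, Module ℝ (V x)] [∀ x, TopologicalSpace (V x)] [FiberBundle F V] [VectorBundle ℝ F V]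
  {n : ℕ}

variable (I) in
/-- The constant function with value `c`, as an element of `C^∞(M)`. -/
noncomputable def constFun (c : ℝ) : SmoothFun I M := ⟨fun _ => c, contMDiff_const⟩

theorem gauge_lie_constFun (D : Gauge I F V) (c : ℝ) : ⁅D, (constFun I c : SmoothFun I M)⁆ = 0 := by
  ext x
  change mvfderiv I (fun _ => c) x (anchor I F V D x) = 0
  rw [mvfderiv_const]
  rfl

theorem vbForms_ext {μ ν : vbForms I F V n}
    (h : (μ : Form (SmoothFun I M) (Gauge I F V) (Sec I F V) n) = ν) : μ = ν := Subtype.ext h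

variable [ContMDiffVectorBundle ∞ F V I]

theorem dorfman_fst (e₁ e₂ : OmniSec I F V (n + 1)) : (dorfman e₁ e₂).1 = ⁅e₁.1, e₂.1⁆ := rfl

theorem dorfman_snd_val (e₁ e₂ : OmniSec I F V (n + 1)) :
    (dorfman e₁ e₂).2.1 = lieDer e₁.1 e₂.2.1 - lieDer e₂.1 e₁.2.1 +
      differential (contr e₂.1 e₁.2.1) := rfl

theorem dorfman_smul_right (e₁ e₂ : OmniSec I F V (n + 1)) (f : SmoothFun I M) :
    dorfman e₁ (f • e₂) = f • dorfman e₁ e₂ + dirDeriv (anchor I F V (rho e₁)) f • e₂ := by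
  refine Prod.ext (LieRinehartRing.leibniz_smul_right e₁.1 e₂.1 f) (vbForms_ext ?_)
  change lieDer e₁.1 (f • e₂.2.1) - lieDer (f • e₂.1) e₁.2.1 +
      differential (contr (f • e₂.1) e₁.2.1) =
    f • (lieDer e₁.1 e₂.2.1 - lieDer e₂.1 e₁.2.1 + differential (contr e₂.1 e₁.2.1)) +
      ⁅e₁.1, f⁆ • e₂.2.1
  have h := differential_smul_contr_sub_lieDer_smul f e₂.1 e₁.2.1
  rw [sub_eq_iff_eq_add] at h
  rw [lieDer_smul, contr_smul_left, h]
  simp only [smul_add, smul_sub]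
  abel

theorem dorfman_smul_left_of_lie_eq_zero {f : SmoothFun I M} (hf : ∀ D : Gauge I F V, ⁅D, f⁆ = 0)
    (e₁ e₂ : OmniSec I F V (n + 1)) : dorfman (f • e₁) e₂ = f • dorfman e₁ e₂ := by
  refine Prod.ext (smul_lie_of_lie_eq_zero hf e₁.1 e₂.1) (vbForms_ext ?_)
  change lieDer (f • e₁.1) e₂.2.1 - lieDer e₂.1 (f • e₁.2.1) +
      differential (contr e₂.1 (f • e₁.2.1)) =
    f • (lieDer e₁.1 e₂.2.1 - lieDer e₂.1 e₁.2.1 + differential (contr e₂.1 e₁.2.1))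
  rw [lieDer_smul_left_of_lie_eq_zero hf, lieDer_smul, hf, zero_smul, add_zero, contr_smul,
    differential_smul_of_lie_eq_zero hf, smul_add, smul_sub]

theorem dorfman_add_left (e₁ e₂ e₃ : OmniSec I F V (n + 1)) :
    dorfman (e₁ + e₂) e₃ = dorfman e₁ e₃ + dorfman e₂ e₃ := by
  refine Prod.ext (add_lie e₁.1 e₂.1 e₃.1) (vbForms_ext ?_)
  change lieDer (e₁.1 + e₂.1) e₃.2.1 - lieDer e₃.1 (e₁.2.1 + e₂.2.1) +
      differential (contr e₃.1 (e₁.2.1 + e₂.2.1)) =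
    (lieDer e₁.1 e₃.2.1 - lieDer e₃.1 e₁.2.1 + differential (contr e₃.1 e₁.2.1)) +
    (lieDer e₂.1 e₃.2.1 - lieDer e₃.1 e₂.2.1 + differential (contr e₃.1 e₂.2.1))
  rw [lieDer_add_left, lieDer_add, contr_add, differential_add]
  abel

theorem dorfman_add_right (e₁ e₂ e₃ : OmniSec I F V (n + 1)) :
    dorfman e₁ (e₂ + e₃) = dorfman e₁ e₂ + dorfman e₁ e₃ := by
  refine Prod.ext (lie_add e₁.1 e₂.1 e₃.1) (vbForms_ext ?_)
  change lieDer e₁.1 (e₂.2.1 + e₃.2.1) - lieDer (e₂.1 + e₃.1) e₁.2.1 +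
      differential (contr (e₂.1 + e₃.1) e₁.2.1) =
    (lieDer e₁.1 e₂.2.1 - lieDer e₂.1 e₁.2.1 + differential (contr e₂.1 e₁.2.1)) +
    (lieDer e₁.1 e₃.2.1 - lieDer e₃.1 e₁.2.1 + differential (contr e₃.1 e₁.2.1))
  rw [lieDer_add_left, lieDer_add, contr_add_left, differential_add]
  abel

theorem dorfman_leibniz (e₁ e₂ e₃ : OmniSec I F V (n + 1)) :
    dorfman e₁ (dorfman e₂ e₃) = dorfman (dorfman e₁ e₂) e₃ + dorfman e₂ (dorfman e₁ e₃) := by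
  refine Prod.ext (leibniz_lie e₁.1 e₂.1 e₃.1) (vbForms_ext ?_)
  rw [Prod.snd_add, Submodule.coe_add]
  simp only [dorfman_snd_val, dorfman_fst, lieDer_lie, contr_add, contr_sub, contr_lieDer,
    lieDer_add, lieDer_sub, differential_add, differential_sub, differential_contr_differential]
  -- what remains are terms `d ι_[y, z] μ` and `d 𝔏_y ι_z μ`
  simp only [lieDer_differential]
  abel

theorem lieDer_pairing (e₁ e₂ e₃ : OmniSec I F V (n + 1)) :
    vbLieDer (rho e₁) (pairing e₂ e₃) =
      pairing (dorfman e₁ e₂) e₃ + pairing e₂ (dorfman e₁ e₃) := by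
  refine vbForms_ext ?_
  change lieDer e₁.1 ((constFun I (1 / 2) : SmoothFun I M) •
      (contr e₂.1 e₃.2.1 + contr e₃.1 e₂.2.1)) =
    (constFun I (1 / 2) : SmoothFun I M) • (contr (dorfman e₁ e₂).1 e₃.2.1 +
      contr e₃.1 (dorfman e₁ e₂).2.1) +
    (constFun I (1 / 2) : SmoothFun I M) • (contr e₂.1 (dorfman e₁ e₃).2.1 +
      contr (dorfman e₁ e₃).1 e₂.2.1)
  rw [lieDer_smul, gauge_lie_constFun, zero_smul, add_zero, ← smul_add]
  congr 1
  simp only [dorfman_fst, dorfman_snd_val, contr_add, contr_sub, contr_lieDer, lieDer_add]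
  rw [← lie_skew e₂.1 e₃.1, contr_neg_left, ← sub_eq_zero, ← sub_eq_zero.mpr
    (contr_differential_contr_add e₂.1 e₃.1 e₁.2.1).symm]
  abel

theorem dorfman_self (e : OmniSec I F V (n + 1)) :
    dorfman e e = (0, vbDiff (pairing e e)) := by
  have h : pairing e e = vbContr e.1 e.2 := by
    rw [pairing, ← two_smul ℝ, smul_smul]
    norm_num
  rw [h, dorfman, lie_self, sub_self, zero_add]

end Dorfman

end OmniLie

theorem theorem2 {EB : Type*} [NormedAddCommGroup EB] [NormedSpace ℝ EB] [FiniteDimensional ℝ EB]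
    {H : Type*} [TopologicalSpace H] {I : ModelWithCorners ℝ EB H}
    {M : Type*} [TopologicalSpace M] [ChartedSpace H M] [IsManifold I ∞ M]
    [T2Space M] [SigmaCompactSpace M]
    {F : Type*} [NormedAddCommGroup F] [NormedSpace ℝ F] [FiniteDimensional ℝ F]
    {V : M → Type*} [TopologicalSpace (Bundle.TotalSpace F V)] [∀ x, AddCommGroup (V x)]
    [∀ x, Module ℝ (V x)] [∀ x, TopologicalSpace (V x)] [FiberBundle F V] [VectorBundle ℝ F V]
    [ContMDiffVectorBundle ∞ F V I] (n : ℕ) :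
    OmniLie.IsLeibnizAlgebra ℝ (OmniLie.OmniSec I F V (n + 1)) OmniLie.dorfman ∧
    (∀ e₁ e₂ : OmniLie.OmniSec I F V (n + 1),
      OmniLie.rho (OmniLie.dorfman e₁ e₂) = ⁅OmniLie.rho e₁, OmniLie.rho e₂⁆) ∧
    (∀ (e₁ e₂ : OmniLie.OmniSec I F V (n + 1)) (f : OmniLie.SmoothFun I M),
      OmniLie.dorfman e₁ (f • e₂) =
        f • OmniLie.dorfman e₁ e₂ + OmniLie.dirDeriv (OmniLie.anchor I F V (OmniLie.rho e₁)) f • e₂) ∧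
    (∀ e₁ e₂ e₃ : OmniLie.OmniSec I F V (n + 1),
      OmniLie.vbLieDer (OmniLie.rho e₁) (OmniLie.pairing e₂ e₃) =
        OmniLie.pairing (OmniLie.dorfman e₁ e₂) e₃ + OmniLie.pairing e₂ (OmniLie.dorfman e₁ e₃)) ∧
    (∀ e : OmniLie.OmniSec I F V (n + 1),
      OmniLie.dorfman e e = (0, OmniLie.vbDiff (OmniLie.pairing e e))) := by
  refine ⟨⟨OmniLie.dorfman_add_left, OmniLie.dorfman_add_right, fun c e₁ e₂ => ?_,
    fun c e₁ e₂ => ?_, OmniLie.dorfman_leibniz⟩, fun _ _ => rfl, OmniLie.dorfman_smul_right,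
    OmniLie.lieDer_pairing, OmniLie.dorfman_self⟩
  · exact OmniLie.dorfman_smul_left_of_lie_eq_zero
      (fun D => OmniLie.gauge_lie_constFun D c) e₁ e₂
  · refine (OmniLie.dorfman_smul_right e₁ e₂ (OmniLie.constFun I c)).trans ?_
    have h : OmniLie.dirDeriv (OmniLie.anchor I F V (OmniLie.rho e₁)) (OmniLie.constFun I c) = 0 :=
      OmniLie.gauge_lie_constFun e₁.1 c
    rw [h, zero_smul, add_zero]
    rfl
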